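/- Let $X$ be a finite set with $n$ elements, and let $S : X\times X\to X\times X$ be a map, written $S(x,y)=(g_x(y),f_y(x))$ with maps $g_x, f_x : X\to X$ for $x\in X$. Assume that $(X,S)$ is a non-degenerate symmetric set-theoretical solution of the quantum Yang--Baxter equation, that is: - all the maps $g_x$ and $f_x$ are bijective; - $S$ is involutive: $S\circ S=\mathrm{Id}_{X\times X}$; - $S$ is braided: $S^{12}S^{23}S^{12}=S^{23}S^{12}S^{23}$ on $X^3$, where $S^{i\,i+1}$ means $S$ acting on the $i$-th and $(i+1)$-th components. The structure group of $(X,S)$ is $$G(X,S)=\langle\, X \mid xy=g_x(y)f_y(x)\ ;\ x,y\in X,\ S(x,y)\neq(x,y)\,\rangle .$$ Let $V$ be a real vector space having $X$ as a basis, put $\varphi_x=f_x^{-1}$, and let $\psi_x\in GL(V)$ be the linear map with $\psi_x(y)=\varphi_x(y)$ for $y\in X$, $y\neq x$, and $\psi_x(x)=-\varphi_x(x)$. The map $x\mapsto\psi_x$ extends to a group homomorphism $\psi: G(X,S)\to GL(V)$; let $W(X,S)=\psi(G(X,S))$ be its image, and let $\mathbf X=\{\psi_x\mid x\in X\}\subseteq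 W(X,S)$. A pair $(x,y)\in X\times X$ is called frozen if $S(x,y)=(x,y)$. One says that $(X,S)$ verifies Property $(\mathcal C)$ if $g_x\circ g_y=\mathrm{Id}_X$ and $f_y\circ f_x=\mathrm{Id}_X$ for every frozen pair $(x,y)$. If $(X,S)$ verifies Property $(\mathcal C)$, then: 1. the group $W(X,S)$ has the group presentation $$\left\langle\ \mathbf X\ \left|\ \begin{array}{lcl}\psi_x\psi_y=\psi_z\psi_t&;&x,y\in X,\ S(x,y)=(z,t)\neq(x,y)\\ \psi_x\psi_y=1&;&x,y\in X,\ S(x,y)=(x,y)\end{array}\right.\right\rangle ,$$ that is, the inclusion $\mathbf X\subseteq W(X,S)$ induces an isomorphism from the group so presented onto $W(X,S)$; 2. $W(X,S)$ is a finite group of order $2^n$. -/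

import Mathlib

universe u v

namespace YangBaxter

section Maps

variable {X : Type u} (S : X × X → X × X)

/-- `g_x`, the first component: `S (x, y) = (g_x y, f_y x)`. -/
def gMap (x : X) : X → X := fun y => (S (x, y)).1

/-- `f_y`, the second component: `S (x, y) = (g_x y, f_y x)`. -/
def fMap (y : X) : X → X := fun x => (S (x, y)).2

/-- `S` acting on the first and second components of `X³`. -/
def map12 : X × X × X → X × X × X :=
  fun p => ((S (p.1, p.2.1)).1, (S (p.1, p.2.1)).2, p.2.2)

/-- `S` acting on the second and third components of `X³`. -/
def map23 : X × X × X → X × X × X := fun p => (p.1, S p.2)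

/-- All the maps `f_x` and `g_x` are bijections. -/
def Nondegenerate : Prop :=
  ∀ x : X, Function.Bijective (fMap S x) ∧ Function.Bijective (gMap S x)

/-- `S¹² S²³ S¹² = S²³ S¹² S²³`. -/
def Braided : Prop :=
  map12 S ∘ map23 S ∘ map12 S = map23 S ∘ map12 S ∘ map23 S

/-- Symmetric means involutive and braided. -/
def Symmetric : Prop := S ∘ S = id ∧ Braided S

/-- `(x, y)` is a frozen pair if `S (x, y) = (x, y)`. -/
def Frozen (x y : X) : Prop := S (x, y) = (x, y)

/-- Property (C) for a pair `(x, y)`. -/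
def PropertyCPair (x y : X) : Prop :=
  gMap S x ∘ gMap S y = id ∧ fMap S y ∘ fMap S x = id

/-- Property (C) for `(X, S)`: it holds for each frozen pair. -/
def PropertyC : Prop := ∀ x y : X, Frozen S x y → PropertyCPair S x y

/-- The relations `x y = g_x(y) f_y(x)` for `S (x, y) ≠ (x, y)`, as elements of the free group. -/
def structureRels : Set (FreeGroup X) :=
  {r | ∃ x y : X, S (x, y) ≠ (x, y) ∧
    r = FreeGroup.of x * FreeGroup.of y *
      (FreeGroup.of (gMap S x y) * FreeGroup.of (fMap S y x))⁻¹}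

/-- The structure group `G(X, S)`. -/
abbrev StructureGroup : Type u := PresentedGroup (structureRels S)

end Maps

section Rep

variable {X : Type u} {S : X × X → X × X} {V : Type v} [AddCommGroup V] [Module ℝ V]

/-- `φ_x = f_x⁻¹`, as a permutation of `X`. -/
noncomputable def phi (hS : Nondegenerate S) (x : X) : Equiv.Perm X :=
  (Equiv.ofBijective (fMap S x) (hS x).1).symm

open Classical in
/-- `ψ_x` on basis vectors: `ψ_x(y) = φ_x(y)` for `y ≠ x` and `ψ_x(x) = -φ_x(x)`. -/
noncomputable def psiVec (hS : Nondegenerate S) (b : Module.Basis X ℝ V) (x y : X) : V :=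
  if y = x then -b (phi hS x y) else b (phi hS x y)

open Classical in
/-- The values on basis vectors of the inverse of `ψ_x`. -/
noncomputable def psiInvVec (hS : Nondegenerate S) (b : Module.Basis X ℝ V) (x z : X) : V :=
  if (phi hS x).symm z = x then -b ((phi hS x).symm z) else b ((phi hS x).symm z)

/-- The linear automorphism `ψ_x` of `V`, where `X` is viewed as a basis of `V` through `b`. -/
noncomputable def psi (hS : Nondegenerate S) (b : Module.Basis X ℝ V) (x : X) :
    LinearMap.GeneralLinearGroup ℝ V where
  val := b.constr ℝ (psiVec hS b x)
  inv := b.constr ℝ (psiInvVec hS b x)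
  val_inv := by
    refine b.ext fun z => ?_
    by_cases h : (phi hS x).symm z = x
    · have h' : z = phi hS x x := (Equiv.symm_apply_eq _).1 h
      simp [Module.End.mul_apply, psiVec, psiInvVec, h']
    · simp [Module.End.mul_apply, psiVec, psiInvVec, h]
  inv_val := by
    refine b.ext fun z => ?_
    by_cases h : z = x <;> simp [Module.End.mul_apply, psiVec, psiInvVec, h]

open Classical in
theorem psi_basis (hS : Nondegenerate S) (b : Module.Basis X ℝ V) (x y : X) :
    (psi hS b x : V →ₗ[ℝ] V) (b y) = if y = x then -b (phi hS x y) else b (phi hS x y) := by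
  simp [psi, psiVec]

theorem phi_eq_iff (hS : Nondegenerate S) (x y z : X) : phi hS x y = z ↔ fMap S x z = y := by
  rw [phi, Equiv.symm_apply_eq]
  exact eq_comm

theorem phi_phi (hS : Nondegenerate S) (hsym : Symmetric S) (x y w : X) :
    phi hS x (phi hS y w) = phi hS (gMap S x y) (phi hS (fMap S y x) w) := by
  rw [phi_eq_iff]
  symm
  rw [phi_eq_iff]
  set a := phi hS (gMap S x y) (phi hS (fMap S y x) w) with ha
  have h1 : fMap S (gMap S x y) a = phi hS (fMap S y x) w := (phi_eq_iff hS _ _ _).1 ha.symm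
  have h2 : fMap S (fMap S y x) (fMap S (gMap S x y) a) = w := (phi_eq_iff hS _ _ _).1 h1.symm
  have h3 := congrArg (fun p : X × X × X => p.2.2) (congrFun hsym.2 (a, x, y))
  exact h3.trans h2

/-- The maps `ψ_x` satisfy the defining relations of the structure group. -/
theorem psi_rel (hS : Nondegenerate S) (hsym : Symmetric S) (b : Module.Basis X ℝ V) (x y : X)
    (hxy : S (x, y) ≠ (x, y)) :
    psi hS b x * psi hS b y = psi hS b (gMap S x y) * psi hS b (fMap S y x) := by
  classical
  have key : ∀ x y : X, fMap S (fMap S y x) (gMap S x y) = y := fun x y =>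
    congrArg Prod.snd (congrFun hsym.1 (x, y))
  have hne : fMap S y x ≠ y := by
    intro h
    apply hxy
    have h1 := key x y
    rw [h] at h1
    have h2 : gMap S x y = x := (hS y).1.1 (h1.trans h.symm)
    exact Prod.ext h2 h
  ext1
  refine b.ext fun w => ?_
  have hpp := phi_phi hS hsym x y w
  have e1 : phi hS y w = x ↔ w = fMap S y x := by
    rw [phi_eq_iff]; exact eq_comm
  have e2 : phi hS (fMap S y x) w = gMap S x y ↔ w = y := by
    rw [phi_eq_iff, key x y]; exact eq_comm
  simp only [Units.val_mul, Module.End.mul_apply, psi_basis]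
  by_cases h1 : w = y
  · have h2 : w ≠ fMap S y x := fun h => hne (h ▸ h1)
    rw [if_pos h1, if_neg h2, map_neg, psi_basis, psi_basis, if_neg (fun h => h2 (e1.1 h)),
      if_pos (e2.2 h1), hpp]
  · by_cases h2 : w = fMap S y x
    · rw [if_neg h1, if_pos h2, map_neg, psi_basis, psi_basis, if_pos (e1.2 h2),
        if_neg (fun h => h1 (e2.1 h)), hpp]
    · rw [if_neg h1, if_neg h2, psi_basis, psi_basis, if_neg (fun h => h2 (e1.1 h)),
        if_neg (fun h => h1 (e2.1 h)), hpp]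

theorem lift_psi_rels (hS : Nondegenerate S) (hsym : Symmetric S) (b : Module.Basis X ℝ V) :
    ∀ r ∈ structureRels S, FreeGroup.lift (psi hS b) r = 1 := by
  rintro r ⟨x, y, hxy, rfl⟩
  simp only [map_mul, map_inv, FreeGroup.lift_apply_of]
  rw [mul_inv_eq_one]
  exact psi_rel hS hsym b x y hxy

/-- The linear representation `ψ : G(X, S) → GL(V)` sending `x` to `ψ_x`. -/
noncomputable def psiHom (hS : Nondegenerate S) (hsym : Symmetric S) (b : Module.Basis X ℝ V) :
    StructureGroup S →* LinearMap.GeneralLinearGroup ℝ V :=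
  PresentedGroup.toGroup (lift_psi_rels hS hsym b)

/-- The group `W(X, S) = ψ(G(X, S))`. -/
noncomputable def W (hS : Nondegenerate S) (hsym : Symmetric S) (b : Module.Basis X ℝ V) :
    Subgroup (LinearMap.GeneralLinearGroup ℝ V) :=
  (psiHom hS hsym b).range

/-- `ψ_x` as an element of `W(X, S)`. -/
noncomputable def psiW (hS : Nondegenerate S) (hsym : Symmetric S) (b : Module.Basis X ℝ V)
    (x : X) : W hS hsym b :=
  ⟨psi hS b x, PresentedGroup.of x, PresentedGroup.toGroup.of (lift_psi_rels hS hsym b)⟩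

/-- The generating set `{ψ_x | x ∈ X}` of `W(X, S)`. -/
def boldX (hS : Nondegenerate S) (hsym : Symmetric S) (b : Module.Basis X ℝ V) :
    Set (W hS hsym b) :=
  Set.range (psiW hS hsym b)

/-- The free generator attached to `ψ_x`. -/
noncomputable def gen (hS : Nondegenerate S) (hsym : Symmetric S) (b : Module.Basis X ℝ V)
    (x : X) : FreeGroup (boldX hS hsym b) :=
  FreeGroup.of ⟨psiW hS hsym b x, x, rfl⟩

/-- The relations `ψ_x ψ_y = ψ_z ψ_t` for `S (x, y) = (z, t) ≠ (x, y)`, and `ψ_x ψ_y = 1` for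
`S (x, y) = (x, y)`, as elements of the free group on `{ψ_x | x ∈ X}`. -/
def quotientRels (hS : Nondegenerate S) (hsym : Symmetric S) (b : Module.Basis X ℝ V) :
    Set (FreeGroup (boldX hS hsym b)) :=
  {r | ∃ x y z t : X, S (x, y) = (z, t) ∧ (z, t) ≠ (x, y) ∧
    r = gen hS hsym b x * gen hS hsym b y * (gen hS hsym b z * gen hS hsym b t)⁻¹} ∪
  {r | ∃ x y : X, Frozen S x y ∧ r = gen hS hsym b x * gen hS hsym b y}

end Rep

end YangBaxter

/-!
Write `q x` for the generators of the presented group. It acts on `X` by `q x ↦ φ_x`, and the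
defining relations say precisely that the maps `g ↦ q (g • a) * g`, for `a` in `X`, are commuting
involutions of the group. Applying those indexed by a finite `A ⊆ X` to `1` gives an element `u A`,
and every element is of this form because left multiplication by a generator agrees at each `g` with
one of these involutions. On the other hand, the `a`-th involution changes which basis vectors are
negated exactly at `a`, so `u A` acts on `V` as a signed permutation negating exactly the vectors
of `A`. Hence `A ↦ u A` is a bijection which stays injective after passing to `W(X, S)`.
-/

namespace YangBaxter

section Toggle

variable {X G : Type*} [Group G] (q : X → G) (φ : G →* Equiv.Perm X)

/-- For a family `q` in a group acting on `X` through `φ`, the map `g ↦ q (g • a) * g`. These maps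
run along the edges of the Cayley graph of `q`; twisting the label `a` by `g` is what makes maps
with different labels commute. -/
def toggle (a : X) (g : G) : G := q (φ g a) * g

variable {q φ}

theorem toggle_toggle (a c : X) (g : G) :
    toggle q φ a (toggle q φ c g) = q (φ (q (φ g c)) (φ g a)) * q (φ g c) * g := by
  simp only [toggle, map_mul, Equiv.Perm.mul_apply, mul_assoc]

theorem leftCommutative_toggle
    (hcomm : ∀ x y, q (φ (q y) x) * q y = q (φ (q x) y) * q x) :
    LeftCommutative (toggle q φ) where
  left_comm a c g := by rw [toggle_toggle, toggle_toggle, hcomm]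

theorem toggle_involutive (hinv : ∀ x, q (φ (q x) x) * q x = 1) (a : X) :
    Function.Involutive (toggle q φ a) := fun g => by
  rw [toggle_toggle, hinv, one_mul]

theorem mul_eq_toggle (x : X) (g : G) : q x * g = toggle q φ ((φ g).symm x) g := by
  rw [toggle, Equiv.apply_symm_apply]

variable [LeftCommutative (toggle q φ)]

variable (q φ) in
/-- The element of `G` obtained from `1` by applying the commuting maps `toggle q φ a`, `a ∈ A`. -/
def ofSubset (A : Finset X) : G := A.val.foldr (toggle q φ) 1

theorem ofSubset_empty : ofSubset q φ ∅ = 1 := rfl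

theorem ofSubset_insert [DecidableEq X] {a : X} {A : Finset X} (ha : a ∉ A) :
    ofSubset q φ (insert a A) = toggle q φ a (ofSubset q φ A) := by
  rw [ofSubset, Finset.insert_val_of_notMem ha, Multiset.foldr_cons, ofSubset]

theorem toggle_ofSubset [DecidableEq X] (hinv : ∀ x, q (φ (q x) x) * q x = 1) (a : X)
    (A : Finset X) :
    toggle q φ a (ofSubset q φ A) = ofSubset q φ (symmDiff {a} A) := by
  by_cases ha : a ∈ A
  · have hA : symmDiff {a} A = A.erase a := by grind [Finset.mem_symmDiff]
    conv_lhs => rw [← Finset.insert_erase ha, ofSubset_insert (Finset.notMem_erase a A)]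
    rw [toggle_involutive hinv, hA]
  · have hA : symmDiff {a} A = insert a A := by grind [Finset.mem_symmDiff]
    rw [hA, ofSubset_insert ha]

theorem ofSubset_surjective (hinv : ∀ x, q (φ (q x) x) * q x = 1)
    (hq : Subgroup.closure (Set.range q) = ⊤) : Function.Surjective (ofSubset q φ) := by
  classical
  have mul_mem_range : ∀ x, ∀ g ∈ Set.range (ofSubset q φ),
      q x * g ∈ Set.range (ofSubset q φ) := by
    rintro x _ ⟨A, rfl⟩
    rw [mul_eq_toggle (φ := φ), toggle_ofSubset hinv]
    exact Set.mem_range_self _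
  intro g
  induction hq ▸ Subgroup.mem_top g using Subgroup.closure_induction_left with
  | one => exact ⟨∅, ofSubset_empty⟩
  | mul_left _ hx g _ ih =>
    obtain ⟨x, rfl⟩ := hx
    exact mul_mem_range x g ih
  | inv_mul_cancel _ hx g _ ih =>
    obtain ⟨x, rfl⟩ := hx
    rw [← eq_inv_of_mul_eq_one_left (hinv x)]
    exact mul_mem_range _ g ih

end Toggle

section Relations

variable {X : Type u} {S : X × X → X × X} {G : Type*} [Group G] {p : X → G}

theorem fMap_gMap (hinv : S ∘ S = id) (x y : X) : fMap S (fMap S y x) (gMap S x y) = y :=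
  congrArg Prod.snd (congrFun hinv (x, y))

theorem apply_phi_prod (hS : Nondegenerate S) (hinv : S ∘ S = id) (x y : X) :
    S (phi hS y x, y) = (phi hS x y, x) := by
  have hf : fMap S y (phi hS y x) = x := (phi_eq_iff hS y x _).1 rfl
  have hg := fMap_gMap hinv (phi hS y x) y
  rw [hf] at hg
  exact Prod.ext ((phi_eq_iff hS x y _).2 hg).symm hf

theorem frozen_phi_self (hS : Nondegenerate S) (hinv : S ∘ S = id) (x : X) :
    Frozen S (phi hS x x) x :=
  apply_phi_prod hS hinv x x

theorem Frozen.phi_self {x y : X} (h : Frozen S x y) (hS : Nondegenerate S) : phi hS y y = x :=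
  (phi_eq_iff hS y y x).2 (congrArg Prod.snd h)

variable (S p) in
/-- The family `p` satisfies the relations of the presentation of `W(X, S)`, the generator `ψ_x`
being replaced by `p x`. -/
structure RespectsRels : Prop where
  mul_eq_of_ne : ∀ {x y}, S (x, y) ≠ (x, y) → p x * p y = p (gMap S x y) * p (fMap S y x)
  mul_eq_one_of_frozen : ∀ {x y}, Frozen S x y → p x * p y = 1

theorem RespectsRels.phi_mul_comm (hp : RespectsRels S p) (hS : Nondegenerate S)
    (hinv : S ∘ S = id) (x y : X) : p (phi hS y x) * p y = p (phi hS x y) * p x := by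
  have happly := apply_phi_prod hS hinv x y
  by_cases hfrozen : S (phi hS y x, y) = (phi hS y x, y)
  · have hxy : x = y := congrArg Prod.snd (happly.symm.trans hfrozen)
    rw [hxy]
  · have hg : gMap S (phi hS y x) y = phi hS x y := congrArg Prod.fst happly
    have hf : fMap S y (phi hS y x) = x := congrArg Prod.snd happly
    rw [hp.mul_eq_of_ne hfrozen, hg, hf]

theorem RespectsRels.phi_mul_self (hp : RespectsRels S p) (hS : Nondegenerate S)
    (hinv : S ∘ S = id) (x : X) : p (phi hS x x) * p x = 1 :=
  hp.mul_eq_one_of_frozen (frozen_phi_self hS hinv x)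

theorem phi_mul_phi_of_frozen (hS : Nondegenerate S) (hC : PropertyC S) {x y : X}
    (h : Frozen S x y) : phi hS x * phi hS y = 1 := by
  ext w
  rw [Equiv.Perm.mul_apply, phi_eq_iff, Equiv.Perm.one_apply, eq_comm, phi_eq_iff]
  exact congrFun (hC x y h).2 w

theorem respectsRels_phi (hS : Nondegenerate S) (hsym : Symmetric S) (hC : PropertyC S) :
    RespectsRels S (phi hS) where
  mul_eq_of_ne _ := Equiv.ext (phi_phi hS hsym _ _)
  mul_eq_one_of_frozen := phi_mul_phi_of_frozen hS hC

end Relations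

section Representation

variable {X : Type u} {S : X × X → X × X} {V : Type v} [AddCommGroup V] [Module ℝ V]
  (hS : Nondegenerate S) (hsym : Symmetric S) (b : Module.Basis X ℝ V)

theorem neg_basis_ne_basis (x y : X) : -b x ≠ b y := by
  classical
  intro h
  have hcoord := congrArg (fun v => b.repr v x) h
  simp only [map_neg, Module.Basis.repr_self, Finsupp.neg_apply, Finsupp.single_apply] at hcoord
  split_ifs at hcoord <;> norm_num at hcoord

theorem psi_mul_psi_of_frozen (hC : PropertyC S) {x y : X} (h : Frozen S x y) :
    psi hS b x * psi hS b y = 1 := by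
  have hphi (w : X) : phi hS x (phi hS y w) = w :=
    Equiv.congr_fun (phi_mul_phi_of_frozen hS hC h) w
  have hsign (w : X) : phi hS y w = x ↔ w = y := by
    rw [← h.phi_self hS, (phi hS y).injective.eq_iff]
  ext1
  refine b.ext fun w => ?_
  by_cases hw : w = y <;> simp [psi_basis, hphi, hsign, hw]

theorem respectsRels_psiW (hC : PropertyC S) : RespectsRels S (psiW hS hsym b) where
  mul_eq_of_ne hxy := Subtype.ext (psi_rel hS hsym b _ _ hxy)
  mul_eq_one_of_frozen h := Subtype.ext (psi_mul_psi_of_frozen hS b hC h)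

theorem psiW_injective : Function.Injective (psiW hS hsym b) := by
  intro x y h
  by_contra hxy
  have hpsi : psi hS b x = psi hS b y := congrArg Subtype.val h
  have happly := psi_basis hS b x x
  rw [hpsi, psi_basis, if_neg hxy, if_pos rfl] at happly
  exact neg_basis_ne_basis b _ _ happly.symm

theorem closure_range_psiW : Subgroup.closure (Set.range (psiW hS hsym b)) = ⊤ := by
  let f : StructureGroup S →* W hS hsym b := (psiHom hS hsym b).rangeRestrict
  have hf : f.range = ⊤ := MonoidHom.range_eq_top.2 (psiHom hS hsym b).rangeRestrict_surjective
  have hpsiW : psiW hS hsym b = f ∘ PresentedGroup.of :=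
    funext fun x => Subtype.ext (PresentedGroup.toGroup.of (lift_psi_rels hS hsym b)).symm
  rw [hpsiW, Set.range_comp, ← MonoidHom.map_closure, PresentedGroup.closure_range_of,
    ← MonoidHom.range_eq_map, hf]

section SignedPermutation

variable {hS b} {G : Type*} [Group G] {q : X → G} {φ : G →* Equiv.Perm X}
  [LeftCommutative (toggle q φ)] {F : G →* LinearMap.GeneralLinearGroup ℝ V}

theorem map_ofSubset_basis [DecidableEq X] (hφ : ∀ x, φ (q x) = phi hS x)
    (hF : ∀ x, F (q x) = psi hS b x) (A : Finset X) (w : X) :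
    (F (ofSubset q φ A) : V →ₗ[ℝ] V) (b w) =
      if w ∈ A then -b (φ (ofSubset q φ A) w) else b (φ (ofSubset q φ A) w) := by
  induction A using Finset.induction_on with
  | empty => simp [ofSubset_empty]
  | insert a A ha ih =>
    rw [ofSubset_insert ha, toggle, map_mul, map_mul, hF, hφ, Units.val_mul,
      Module.End.mul_apply, ih]
    by_cases hw : w = a
    · simp [ha, hw, psi_basis]
    · by_cases hA : w ∈ A <;> simp [hA, hw, psi_basis]

theorem map_ofSubset_injective (hφ : ∀ x, φ (q x) = phi hS x) (hF : ∀ x, F (q x) = psi hS b x) :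
    Function.Injective (F ∘ ofSubset q φ) := by
  classical
  intro A B (hAB : F (ofSubset q φ A) = F (ofSubset q φ B))
  ext w
  have hw := map_ofSubset_basis hφ hF A w
  rw [hAB, map_ofSubset_basis hφ hF] at hw
  by_cases hA : w ∈ A <;> by_cases hB : w ∈ B <;> simp only [hA, hB, if_true, if_false] at hw ⊢
  · exact (neg_basis_ne_basis b _ _ hw.symm).elim
  · exact (neg_basis_ne_basis b _ _ hw).elim

end SignedPermutation

section Presentation

/-- The indexing of the generating set `{ψ_x | x ∈ X}` by `X`. -/
noncomputable def boldXEquiv : X ≃ boldX hS hsym b :=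
  Equiv.ofInjective (psiW hS hsym b) (psiW_injective hS hsym b)

/-- The generator attached to `ψ_x` in the group presented by `quotientRels`. -/
noncomputable def quotientGen (x : X) : PresentedGroup (quotientRels hS hsym b) :=
  PresentedGroup.of (boldXEquiv hS hsym b x)

theorem closure_range_quotientGen : Subgroup.closure (Set.range (quotientGen hS hsym b)) = ⊤ := by
  rw [← PresentedGroup.closure_range_of (quotientRels hS hsym b),
    ← (boldXEquiv hS hsym b).surjective.range_comp]
  rfl

theorem respectsRels_quotientGen : RespectsRels S (quotientGen hS hsym b) where
  mul_eq_of_ne {x y} hxy :=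
    mul_inv_eq_one.1 (PresentedGroup.one_of_mem (Or.inl ⟨x, y, _, _, rfl, hxy, rfl⟩))
  mul_eq_one_of_frozen {x y} h := PresentedGroup.one_of_mem (Or.inr ⟨x, y, h, rfl⟩)

variable {G : Type*} [Group G] {p : X → G}

theorem lift_eq_one_of_mem_quotientRels (hp : RespectsRels S p) :
    ∀ r ∈ quotientRels hS hsym b, FreeGroup.lift (p ∘ (boldXEquiv hS hsym b).symm) r = 1 := by
  have lift_gen (x : X) :
      FreeGroup.lift (p ∘ (boldXEquiv hS hsym b).symm) (gen hS hsym b x) = p x :=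
    FreeGroup.lift_apply_of.trans (congrArg p ((boldXEquiv hS hsym b).symm_apply_apply x))
  rintro r (⟨x, y, z, t, h, hne, rfl⟩ | ⟨x, y, h, rfl⟩)
  · obtain ⟨rfl, rfl⟩ : gMap S x y = z ∧ fMap S y x = t := Prod.ext_iff.1 h
    simp only [map_mul, map_inv, lift_gen]
    exact mul_inv_eq_one.2 (hp.mul_eq_of_ne hne)
  · simp only [map_mul, lift_gen]
    exact hp.mul_eq_one_of_frozen h

/-- The universal property of the group presented by `quotientRels`: a family satisfying the
relations extends to a homomorphism. -/
noncomputable def quotientLift (hp : RespectsRels S p) :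
    PresentedGroup (quotientRels hS hsym b) →* G :=
  PresentedGroup.toGroup (lift_eq_one_of_mem_quotientRels hS hsym b hp)

theorem quotientLift_quotientGen (hp : RespectsRels S p) (x : X) :
    quotientLift hS hsym b hp (quotientGen hS hsym b x) = p x :=
  (PresentedGroup.toGroup.of _).trans (congrArg p ((boldXEquiv hS hsym b).symm_apply_apply x))

variable (hC : PropertyC S)

/-- The action of the presented group on `X`, in which the generator `ψ_x` acts by `φ_x`. -/
noncomputable def quotientAction : PresentedGroup (quotientRels hS hsym b) →* Equiv.Perm X :=
  quotientLift hS hsym b (respectsRels_phi hS hsym hC)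

theorem quotientAction_quotientGen (x : X) :
    quotientAction hS hsym b hC (quotientGen hS hsym b x) = phi hS x :=
  quotientLift_quotientGen hS hsym b _ x

instance leftCommutative_toggle_quotientGen :
    LeftCommutative (toggle (quotientGen hS hsym b) (quotientAction hS hsym b hC)) :=
  leftCommutative_toggle fun x y => by
    simpa only [quotientAction_quotientGen] using
      (respectsRels_quotientGen hS hsym b).phi_mul_comm hS hsym.1 x y

theorem ofSubset_quotientGen_surjective :
    Function.Surjective (ofSubset (quotientGen hS hsym b) (quotientAction hS hsym b hC)) := by
  refine ofSubset_surjective (fun x => ?_) (closure_range_quotientGen hS hsym b)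
  rw [quotientAction_quotientGen]
  exact (respectsRels_quotientGen hS hsym b).phi_mul_self hS hsym.1 x

/-- The homomorphism from the presented group to `W(X, S)` induced by the inclusion of
`{ψ_x | x ∈ X}` in `W(X, S)`. -/
noncomputable def quotientToW : PresentedGroup (quotientRels hS hsym b) →* W hS hsym b :=
  quotientLift hS hsym b (respectsRels_psiW hS hsym b hC)

theorem quotientToW_of (w : boldX hS hsym b) :
    quotientToW hS hsym b hC (PresentedGroup.of w) = w := by
  obtain ⟨_, x, rfl⟩ := w
  exact quotientLift_quotientGen hS hsym b _ x

theorem quotientToW_surjective : Function.Surjective (quotientToW hS hsym b hC) := by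
  rw [← MonoidHom.range_eq_top, eq_top_iff, ← closure_range_psiW, Subgroup.closure_le]
  exact fun w hw => ⟨PresentedGroup.of ⟨w, hw⟩, quotientToW_of hS hsym b hC ⟨w, hw⟩⟩

theorem quotientToW_comp_ofSubset_injective :
    Function.Injective (quotientToW hS hsym b hC ∘
      ofSubset (quotientGen hS hsym b) (quotientAction hS hsym b hC)) :=
  .of_comp (f := Subtype.val) <|
    map_ofSubset_injective (F := (W hS hsym b).subtype.comp (quotientToW hS hsym b hC))
      (quotientAction_quotientGen hS hsym b hC)
      fun x => congrArg Subtype.val (quotientLift_quotientGen hS hsym b _ x)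

theorem quotientToW_bijective : Function.Bijective (quotientToW hS hsym b hC) :=
  ⟨(quotientToW_comp_ofSubset_injective hS hsym b hC).of_comp_right
    (ofSubset_quotientGen_surjective hS hsym b hC), quotientToW_surjective hS hsym b hC⟩

theorem quotientToW_comp_ofSubset_bijective :
    Function.Bijective (quotientToW hS hsym b hC ∘
      ofSubset (quotientGen hS hsym b) (quotientAction hS hsym b hC)) :=
  ⟨quotientToW_comp_ofSubset_injective hS hsym b hC,
    (quotientToW_surjective hS hsym b hC).comp (ofSubset_quotientGen_surjective hS hsym b hC)⟩

end Presentation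

end Representation

end YangBaxter

theorem mainTheorem4_general {X : Type u} (S : X × X → X × X)
    (hnd : YangBaxter.Nondegenerate S) (hsym : YangBaxter.Symmetric S)
    {V : Type v} [AddCommGroup V] [Module ℝ V] (b : Module.Basis X ℝ V)
    (hC : YangBaxter.PropertyC S) :
    (∃ e : PresentedGroup (YangBaxter.quotientRels hnd hsym b) ≃* YangBaxter.W hnd hsym b,
      ∀ w : YangBaxter.boldX hnd hsym b, e (PresentedGroup.of w) = (w : YangBaxter.W hnd hsym b)) ∧
    Nonempty (Finset X ≃ YangBaxter.W hnd hsym b) :=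
  ⟨⟨.ofBijective _ (YangBaxter.quotientToW_bijective hnd hsym b hC),
    YangBaxter.quotientToW_of hnd hsym b hC⟩,
    ⟨.ofBijective _ (YangBaxter.quotientToW_comp_ofSubset_bijective hnd hsym b hC)⟩⟩

theorem mainTheorem4 {X : Type u} [Finite X] (S : X × X → X × X)
    (hnd : YangBaxter.Nondegenerate S) (hsym : YangBaxter.Symmetric S)
    {V : Type v} [AddCommGroup V] [Module ℝ V] (b : Module.Basis X ℝ V)
    (hC : YangBaxter.PropertyC S) :
    (∃ e : PresentedGroup (YangBaxter.quotientRels hnd hsym b) ≃* YangBaxter.W hnd hsym b,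
      ∀ w : YangBaxter.boldX hnd hsym b, e (PresentedGroup.of w) = (w : YangBaxter.W hnd hsym b)) ∧
    Nat.card (YangBaxter.W hnd hsym b) = 2 ^ Nat.card X := by
  obtain ⟨he, ⟨u⟩⟩ := mainTheorem4_general S hnd hsym b hC
  have := Fintype.ofFinite X
  exact ⟨he, by rw [← Nat.card_congr u]; simp [Nat.card_eq_fintype_card]⟩
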